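/- Manifolds are smooth, finite-dimensional and Hausdorff, and each of them has a fixed dimension. A map $\pi\colon M\to S$ from a manifold to a set is a *$Q$-chart* if (a) whenever $\pi(x)=\pi(y)$ there is a diffeomorphism $h$ between open neighbourhoods of $x$ and $y$ in $M$ with $h(x)=y$ and $\pi\circ h=\pi$ on the domain of $h$; and (b) for every manifold $T$ and smooth $f,h\colon T\to M$ with $\pi\circ f=\pi\circ h$, the set $\{t\in T: f(t)=h(t)\}$ is open. A surjective $Q$-chart is a *$Q$-atlas*. Two $Q$-charts are equivalent if their disjoint union is a $Q$-chart, and a *$Q$-manifold* is a set with an equivalence class of $Q$-atlases; its $Q$-charts are those equivalent to its $Q$-atlases. A map $f\colon S_1\to S_2$ of $Q$-manifolds is *$Q$-smooth* if for every $s\in S_1$ there are $Q$-charts $\pi_j\colon M_j\to S_j$, a smooth map $\widehat f\colon M_1\to M_2$ and $m\in M_1$ with $\pi_1(m)=s$ and $f\circ\pi_1=\pi_2\circ\widehat f$. Manifolds, products of $Q$-manifolds, and open subsets of $Q$-manifolds (those whose preimage under a $Q$-atlas is open) are $Q$-manifolds in the natural way. A *$Q$-group* is a group and $Q$-manifold whose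 multiplication and inversion are $Q$-smooth. Let $G$ be a $Q$-group and $N$ a manifold. A *$Q$-principal bundle* over $N$ with structure group $G$ is a $Q$-manifold $P$ with a free $Q$-smooth right action $P\times G\to P$ and a $Q$-smooth map $\beta\colon P\to N$ such that $\beta^{-1}(\beta(p))=pG$ for all $p\in P$, and every point of $N$ has an open neighbourhood $U$ over which there is a local trivialization, i.e. a $G$-equivariant $Q$-diffeomorphism $\beta^{-1}(U)\to U\times G$, $p\mapsto(\beta(p),\varphi(p))$. **Proposition 3.7.** Let $G$ be a $Q$-group, $N$ a smooth manifold, $N=\bigcup_{i\in I}U_i$ an open covering, and $\psi_{ji}\colon U_i\cap U_j\to G$ $(i,j\in I)$ $Q$-smooth maps with $\psi_{ki}(n)=\psi_{kj}(n)\psi_{ji}(n)$ for all $i,j,k\in I$ and $n\in U_i\cap U_j\cap U_k$. Then there exist a $Q$-principal bundle $\beta\colon P\to N$ with structure group $G$ and local trivializations $p\mapsto(\beta(p),\varphi_i(p))$ over $U_i$ for all $i\in I$, whose transition functions are the $\psi_{ji}$: $$\psi_{ji}(\beta(p))=\varphi_j(p)\varphi_i(p)^{-1}\qquad(i,j\in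 I,\ p\in\beta^{-1}(U_i\cap U_j)).$$ Moreover, for every $Q$-atlas $q\colon M\to G$ of the $Q$-manifold $G$ (in particular, with $M=\widetilde G$, whenever $\widetilde G$ is a Lie group and $q\colon\widetilde G\to G$ is a surjective homomorphism that is a $Q$-atlas of $G$), the map $$\pi_P\colon\bigsqcup_{i\in I}U_i\times M\to P$$ that sends $(i,n,m)$ to the unique $p\in\beta^{-1}(n)$ with $\varphi_i(p)=q(m)$ is a $Q$-atlas of the $Q$-manifold $P$. It satisfies $\beta(\pi_P(i,n,m))=n$, and $\pi_P(i,n,m)\,g=\pi_P(i,n,m')$ whenever $q(m')=q(m)g$; and it exhibits $P$ as the quotient by the relation $$\pi_P(i_1,n_1,m_1)=\pi_P(i_2,n_2,m_2)\iff n_1=n_2=:n\in U_{i_1}\cap U_{i_2}\ \text{ and }\ q(m_2)=\psi_{i_2i_1}(n)\,q(m_1).$$ -/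

import Mathlib

open TopologicalSpace
open scoped Manifold ContDiff

universe u v

namespace QGeom

/-! ### Smooth manifolds (finite-dimensional, Hausdorff, not necessarily second countable) -/

/-- A smooth manifold modelled on the finite-dimensional real normed space `E`. -/
structure SmoothMfd (E : Type) [NormedAddCommGroup E] [NormedSpace ℝ E] [FiniteDimensional ℝ E] :
    Type (u + 1) where
  carrier : Type u
  [topology : TopologicalSpace carrier]
  [t2 : T2Space carrier]
  [charts : ChartedSpace E carrier]
  [smooth : IsManifold 𝓘(ℝ, E) ∞ carrier]

attribute [instance] SmoothMfd.topology SmoothMfd.t2 SmoothMfd.charts SmoothMfd.smooth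

section SigmaManifold

variable {E : Type} [NormedAddCommGroup E] {ι : Type u} {X : ι → Type u}
  [∀ i, TopologicalSpace (X i)] [∀ i, ChartedSpace E (X i)]

/-- The charts of a disjoint union are the charts of the pieces. -/
noncomputable instance sigmaChartedSpace : ChartedSpace E (Σ i, X i) where
  atlas := {e | ∃ (i : ι), ∃ f ∈ atlas E (X i),
    e = f.lift_openEmbedding (Topology.IsOpenEmbedding.sigmaMk (i := i))}
  chartAt p := (chartAt E p.2).lift_openEmbedding (Topology.IsOpenEmbedding.sigmaMk (i := p.1))
  mem_chart_source p := ⟨p.2, mem_chart_source E p.2, rfl⟩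
  chart_mem_atlas p := ⟨p.1, _, chart_mem_atlas E p.2, rfl⟩

instance sigmaIsManifold [NormedSpace ℝ E] [h : ∀ i, IsManifold 𝓘(ℝ, E) ∞ (X i)] :
    IsManifold 𝓘(ℝ, E) ∞ (Σ i, X i) where
  compatible {e} e' he he' := by
    obtain ⟨i, f, hf, rfl⟩ := he
    obtain ⟨j, f', hf', rfl⟩ := he'
    by_cases hij : i = j
    · subst hij
      rw [f.lift_openEmbedding_trans f']
      exact (h i).compatible hf hf'
    · apply ContDiffGroupoid.mem_of_source_eq_empty
      ext x
      refine ⟨fun ⟨_, hx₂⟩ => ?_, fun hx => hx.elim⟩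
      obtain ⟨y, _, hy⟩ := hx₂
      exact hij (congrArg Sigma.fst hy).symm

end SigmaManifold

section Constructions

variable {E : Type} [NormedAddCommGroup E] [NormedSpace ℝ E] [FiniteDimensional ℝ E]
variable {F : Type} [NormedAddCommGroup F] [NormedSpace ℝ F] [FiniteDimensional ℝ F]

namespace SmoothMfd

instance : CoeSort (SmoothMfd.{u} E) (Type u) := ⟨SmoothMfd.carrier⟩

/-- Smooth maps between manifolds. -/
def Smooth {M : SmoothMfd.{u} E} {N : SmoothMfd.{v} F} (f : M → N) : Prop :=
  ContMDiff 𝓘(ℝ, E) 𝓘(ℝ, F) ∞ f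

/-- An open subset of a manifold, as a manifold. -/
@[reducible] noncomputable def opens (M : SmoothMfd.{u} E) (U : Opens M) : SmoothMfd.{u} E where
  carrier := U

/-- The disjoint union of two manifolds. -/
@[reducible] noncomputable def sum (M N : SmoothMfd.{u} E) : SmoothMfd.{u} E where
  carrier := M ⊕ N

/-- The disjoint union of a family of manifolds. -/
@[reducible] noncomputable def sigma {ι : Type u} (M : ι → SmoothMfd.{u} E) : SmoothMfd.{u} E where
  carrier := Σ i, M i

/-- The Cartesian product of two manifolds. -/
@[reducible] def prod (M : SmoothMfd.{u} E) (N : SmoothMfd.{u} F) : SmoothMfd.{u} (E × F) where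
  carrier := M × N
  charts := prodChartedSpace E M F N
  smooth := by
    rw [modelWithCornersSelf_prod]
    exact IsManifold.prod (I := 𝓘(ℝ, E)) (I' := 𝓘(ℝ, F)) M N

theorem smooth_prod_iff {D : Type} [NormedAddCommGroup D] [NormedSpace ℝ D] [FiniteDimensional ℝ D]
    {T : SmoothMfd.{u} D} {M : SmoothMfd.{u} E} {N : SmoothMfd.{u} F} (f : T → M.prod N) :
    Smooth f ↔ Smooth (M := T) (N := M) (fun t => (f t).1) ∧
      Smooth (M := T) (N := N) (fun t => (f t).2) := by
  unfold Smooth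
  rw [modelWithCornersSelf_prod]
  exact contMDiff_prod_iff (I' := 𝓘(ℝ, E)) (J' := 𝓘(ℝ, F)) f

end SmoothMfd

/-! ### `Q`-charts, `Q`-atlases, `Q`-manifolds -/

/-- A `Q`-chart `π : M → S` on a set `S`:
(a) points with the same image are related by a diffeomorphism `h` between open neighbourhoods
    with `π ∘ h = π`;
(b) two smooth maps into `M` with the same composition with `π` coincide on an open set. -/
structure IsQChart {M : SmoothMfd.{u} E} {S : Type u} (π : M → S) : Prop where
  transverse : ∀ x y : M, π x = π y → ∃ h : OpenPartialHomeomorph M M,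
    x ∈ h.source ∧ h x = y ∧
    ContMDiffOn 𝓘(ℝ, E) 𝓘(ℝ, E) ∞ h h.source ∧
    ContMDiffOn 𝓘(ℝ, E) 𝓘(ℝ, E) ∞ h.symm h.target ∧
    ∀ z ∈ h.source, π (h z) = π z
  isOpen_eq : ∀ (D : Type) [NormedAddCommGroup D] [NormedSpace ℝ D] [FiniteDimensional ℝ D]
    (T : SmoothMfd.{u} D) (f g : T → M), SmoothMfd.Smooth f → SmoothMfd.Smooth g →
    π ∘ f = π ∘ g → IsOpen {t | f t = g t}

/-- The map `π₁ ⊔ π₂ : M₁ ⊔ M₂ → S`. -/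
def sumMap {M₁ M₂ : SmoothMfd.{u} E} {S : Type u} (π₁ : M₁ → S) (π₂ : M₂ → S) :
    M₁.sum M₂ → S := Sum.elim π₁ π₂

/-- Equivalence of `Q`-charts: the disjoint union is again a `Q`-chart. -/
def QChartEquiv {M₁ M₂ : SmoothMfd.{u} E} {S : Type u} (π₁ : M₁ → S) (π₂ : M₂ → S) : Prop :=
  IsQChart (sumMap π₁ π₂)

/-- A `Q`-manifold structure on the set `S`, given by one `Q`-atlas (surjective `Q`-chart)
representing its equivalence class. Below, the structure is only used through the notion
`QManifold.IsChart`, which depends only on the equivalence class of the atlas. -/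
structure QManifold (E : Type) [NormedAddCommGroup E] [NormedSpace ℝ E] [FiniteDimensional ℝ E]
    (S : Type u) : Type (u + 1) where
  dom : SmoothMfd.{u} E
  atlas : dom → S
  isQChart : IsQChart atlas
  surjective : Function.Surjective atlas

/-- `π` is a `Q`-chart of the `Q`-manifold, i.e. a `Q`-chart equivalent to its `Q`-atlases. -/
def QManifold.IsChart {S : Type u} (X : QManifold E S) {M : SmoothMfd.{u} E} (π : M → S) : Prop :=
  IsQChart π ∧ QChartEquiv π X.atlas

/-- `π` is a `Q`-atlas of the `Q`-manifold, i.e. belongs to its equivalence class of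
`Q`-atlases. -/
def QManifold.IsAtlas {S : Type u} (X : QManifold E S) {M : SmoothMfd.{u} E} (π : M → S) : Prop :=
  X.IsChart π ∧ Function.Surjective π

/-- `Q`-smooth maps: around every point `s` the map `f` lifts through `Q`-charts to a smooth map
(the point `φ m` then lies over `f s`). -/
def IsQSmooth {S R : Type u} (X : QManifold E S) (Y : QManifold F R) (f : S → R) : Prop :=
  ∀ s : S, ∃ (M₁ : SmoothMfd.{u} E) (M₂ : SmoothMfd.{u} F) (π₁ : M₁ → S) (π₂ : M₂ → R)
    (φ : M₁ → M₂) (m : M₁), X.IsChart π₁ ∧ Y.IsChart π₂ ∧ SmoothMfd.Smooth φ ∧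
      π₁ m = s ∧ f ∘ π₁ = π₂ ∘ φ

/-! ### Smooth manifolds, products and open subsets as `Q`-manifolds -/

/-- A smooth manifold is a `Q`-manifold, with the identity as `Q`-atlas. -/
def QManifold.ofManifold (N : SmoothMfd.{u} E) : QManifold E N where
  dom := N
  atlas := id
  isQChart :=
    { transverse := fun x y hxy => ⟨OpenPartialHomeomorph.refl N, by simp, by simpa using hxy,
        contMDiffOn_id, contMDiffOn_id, by simp⟩
      isOpen_eq := fun D _ _ _ T f g _ _ hfg => by
        have : f = g := hfg
        simp [this] }
  surjective := Function.surjective_id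

/-- The product of two `Q`-manifolds, with the product of `Q`-atlases as `Q`-atlas. -/
def QManifold.prod {S R : Type u} (X : QManifold E S) (Y : QManifold F R) :
    QManifold (E × F) (S × R) where
  dom := X.dom.prod Y.dom
  atlas := Prod.map X.atlas Y.atlas
  isQChart :=
    { transverse := by
        rintro ⟨x, y⟩ ⟨x', y'⟩ hxy
        obtain ⟨h, hx, hxx, hs, hs', hπ⟩ := X.isQChart.transverse x x' (congrArg Prod.fst hxy)
        obtain ⟨k, ky, kyy, ks, ks', kπ⟩ := Y.isQChart.transverse y y' (congrArg Prod.snd hxy)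
        refine ⟨h.prod k, ⟨hx, ky⟩, Prod.ext hxx kyy, ?_, ?_, ?_⟩
        · rw [modelWithCornersSelf_prod]
          exact ContMDiffOn.prodMap (I := 𝓘(ℝ, E)) (J := 𝓘(ℝ, F)) hs ks
        · rw [modelWithCornersSelf_prod]
          exact ContMDiffOn.prodMap (I := 𝓘(ℝ, E)) (J := 𝓘(ℝ, F)) hs' ks'
        · rintro ⟨z, w⟩ ⟨hz, hw⟩
          exact Prod.ext (hπ z hz) (kπ w hw)
      isOpen_eq := fun D _ _ _ T f g hf hg hfg => by
        rw [SmoothMfd.smooth_prod_iff] at hf hg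
        have h₁ := X.isQChart.isOpen_eq D T _ _ hf.1 hg.1
          (funext fun t => congrArg Prod.fst (congrFun hfg t))
        have h₂ := Y.isQChart.isOpen_eq D T _ _ hf.2 hg.2
          (funext fun t => congrArg Prod.snd (congrFun hfg t))
        have : {t | f t = g t} = {t | (f t).1 = (g t).1} ∩ {t | (f t).2 = (g t).2} := by
          ext t
          exact Prod.ext_iff
        rw [this]
        exact h₁.inter h₂ }
  surjective := X.surjective.prodMap Y.surjective

/-- A subset of a `Q`-manifold is open when its preimage under the `Q`-atlas is open. -/
def QManifold.IsOpenSet {S : Type u} (X : QManifold E S) (V : Set S) : Prop :=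
  IsOpen (X.atlas ⁻¹' V)

/-- An open subset `V` of a `Q`-manifold is a `Q`-manifold: restrict the `Q`-atlas to the
preimage of `V`. -/
noncomputable def QManifold.restrict {S : Type u} (X : QManifold E S) (V : Set S) (hV : X.IsOpenSet V) :
    QManifold E V where
  dom := X.dom.opens ⟨X.atlas ⁻¹' V, hV⟩
  atlas := fun x => ⟨X.atlas x.1, x.2⟩
  isQChart :=
    { transverse := by
        let W : Opens X.dom := ⟨X.atlas ⁻¹' V, hV⟩
        intro (x : W) (y : W) hxy
        obtain ⟨h, hx, hxy', hs, hs', hπ⟩ := X.isQChart.transverse x.1 y.1 (congrArg Subtype.val hxy)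
        let c : OpenPartialHomeomorph W X.dom := W.openPartialHomeomorphSubtypeCoe ⟨x⟩
        have hmem : ∀ z : X.dom, z ∈ W → z ∈ h.source → h z ∈ W := fun z hz hzs => by
          change X.atlas (h z) ∈ V
          rw [hπ z hzs]; exact hz
        have hmem' : ∀ z : X.dom, z ∈ W → z ∈ h.target → h.symm z ∈ W := fun z hz hzs => by
          change X.atlas (h.symm z) ∈ V
          rw [← hπ _ (h.map_target hzs), h.right_inv hzs]; exact hz
        have hc : ∀ z : X.dom, z ∈ W → ((c.symm z : W) : X.dom) = z := fun z hz =>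
          c.right_inv (by simpa [c] using hz)
        have hcs : ∀ z : W, ((c.trans h).trans c.symm) z = c.symm (h z.1) := fun z => rfl
        have hct : ∀ z : W, ((c.trans h).trans c.symm).symm z = c.symm (h.symm z.1) := fun z => rfl
        have src : ∀ z ∈ ((c.trans h).trans c.symm).source, z.1 ∈ h.source := fun z hz => by
          simpa [c] using hz.1
        have tgt : ∀ z ∈ ((c.trans h).trans c.symm).target, z.1 ∈ h.target := fun z hz => by
          have := hz.2
          simp [c] at this
          exact this.1
        refine ⟨(c.trans h).trans c.symm, ?_, ?_, ?_, ?_, ?_⟩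
        · have hy : h x.1 ∈ W := hmem _ x.2 hx
          simp only [OpenPartialHomeomorph.trans_source, c]
          refine ⟨?_, ?_⟩
          · simpa using hx
          · simpa using hy
        · apply Subtype.ext
          rw [hcs, hc _ (hmem _ x.2 hx)]
          exact hxy'
        · intro z hz
          rw [← ContMDiffWithinAt.subtypeVal_comp_iff]
          have h1 : ContMDiffWithinAt 𝓘(ℝ, E) 𝓘(ℝ, E) ∞ (fun w : W => h w.1)
              ((c.trans h).trans c.symm).source z :=
            (hs z.1 (src z hz)).comp z contMDiff_subtype_val.contMDiffAt.contMDiffWithinAt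
              (fun w hw => src w hw)
          refine h1.congr (fun w hw => ?_) ?_
          · exact hc _ (hmem _ w.2 (src w hw))
          · exact hc _ (hmem _ z.2 (src z hz))
        · intro z hz
          rw [← ContMDiffWithinAt.subtypeVal_comp_iff]
          have h1 : ContMDiffWithinAt 𝓘(ℝ, E) 𝓘(ℝ, E) ∞ (fun w : W => h.symm w.1)
              ((c.trans h).trans c.symm).target z :=
            (hs' z.1 (tgt z hz)).comp z contMDiff_subtype_val.contMDiffAt.contMDiffWithinAt
              (fun w hw => tgt w hw)
          refine h1.congr (fun w hw => ?_) ?_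
          · exact hc _ (hmem' _ w.2 (tgt w hw))
          · exact hc _ (hmem' _ z.2 (tgt z hz))
        · intro z hz
          apply Subtype.ext
          change X.atlas (c.symm (h z.1)).1 = X.atlas z.1
          rw [hc _ (hmem _ z.2 (src z hz))]
          exact hπ _ (src z hz)
      isOpen_eq := fun D _ _ _ T f g hf hg hfg => by
        have h₁ := X.isQChart.isOpen_eq D T (fun t => (f t).1) (fun t => (g t).1)
          (contMDiff_subtype_val.comp hf) (contMDiff_subtype_val.comp hg)
          (funext fun t => congrArg Subtype.val (congrFun hfg t))
        simpa only [Subtype.ext_iff] using h₁ }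
  surjective := by
    rintro ⟨s, hs⟩
    obtain ⟨x, rfl⟩ := X.surjective s
    exact ⟨⟨x, hs⟩, rfl⟩

/-- Equivalent `Q`-charts have the same open sets (pointwise, from left to right). -/
theorem QChartEquiv.nhds_left {M₁ M₂ : SmoothMfd.{u} E} {S : Type u} {π₁ : M₁ → S} {π₂ : M₂ → S}
    (h : QChartEquiv π₁ π₂) {x : M₁} {y : M₂} (hxy : π₁ x = π₂ y) {V : Set S}
    (hV : π₁ ⁻¹' V ∈ nhds x) : π₂ ⁻¹' V ∈ nhds y := by
  obtain ⟨k, hk, hkx, hs, -, hπ⟩ := h.transverse (Sum.inr y) (Sum.inl x) hxy.symm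
  have h1 : k ⁻¹' (Sum.inl '' (π₁ ⁻¹' V)) ∈ nhds (Sum.inr y : M₁ ⊕ M₂) := by
    apply (k.continuousAt hk).preimage_mem_nhds
    rw [hkx]
    exact Topology.IsOpenEmbedding.inl.isOpenMap.image_mem_nhds hV
  have h2 := (continuous_inr (X := M₁) (Y := M₂)).continuousAt.preimage_mem_nhds
    (Filter.inter_mem h1 (k.open_source.mem_nhds hk))
  refine Filter.mem_of_superset h2 ?_
  rintro z ⟨⟨w, hw, hwz⟩, hz⟩
  have h3 := hπ _ hz
  rw [← hwz] at h3
  change π₁ w = π₂ z at h3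
  change π₂ z ∈ V
  rw [← h3]
  exact hw

/-- Equivalent `Q`-charts have the same open sets (pointwise, from right to left). -/
theorem QChartEquiv.nhds_right {M₁ M₂ : SmoothMfd.{u} E} {S : Type u} {π₁ : M₁ → S} {π₂ : M₂ → S}
    (h : QChartEquiv π₁ π₂) {x : M₁} {y : M₂} (hxy : π₁ x = π₂ y) {V : Set S}
    (hV : π₂ ⁻¹' V ∈ nhds y) : π₁ ⁻¹' V ∈ nhds x := by
  obtain ⟨k, hk, hkx, hs, -, hπ⟩ := h.transverse (Sum.inl x) (Sum.inr y) hxy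
  have h1 : k ⁻¹' (Sum.inr '' (π₂ ⁻¹' V)) ∈ nhds (Sum.inl x : M₁ ⊕ M₂) := by
    apply (k.continuousAt hk).preimage_mem_nhds
    rw [hkx]
    exact Topology.IsOpenEmbedding.inr.isOpenMap.image_mem_nhds hV
  have h2 := (continuous_inl (X := M₁) (Y := M₂)).continuousAt.preimage_mem_nhds
    (Filter.inter_mem h1 (k.open_source.mem_nhds hk))
  refine Filter.mem_of_superset h2 ?_
  rintro z ⟨⟨w, hw, hwz⟩, hz⟩
  have h3 := hπ _ hz
  rw [← hwz] at h3
  change π₂ w = π₁ z at h3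
  change π₁ z ∈ V
  rw [← h3]
  exact hw

/-- `Q`-smooth maps are continuous. -/
theorem IsQSmooth.isOpenSet_preimage {S R : Type u} {X : QManifold E S} {Y : QManifold F R}
    {f : S → R} (hf : IsQSmooth X Y f) {V : Set R} (hV : Y.IsOpenSet V) :
    X.IsOpenSet (f ⁻¹' V) := by
  refine isOpen_iff_mem_nhds.mpr fun x hx => ?_
  obtain ⟨M₁, M₂, π₁, π₂, φ, m, hπ₁, hπ₂, hφ, hm, hcomp⟩ := hf (X.atlas x)
  refine hπ₁.2.nhds_left hm ?_
  have hval : π₂ (φ m) = f (X.atlas x) := by rw [← hm]; exact (congrFun hcomp m).symm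
  obtain ⟨y, hy⟩ := Y.surjective (f (X.atlas x))
  have h2 : π₂ ⁻¹' V ∈ nhds (φ m) := by
    refine hπ₂.2.nhds_right (hval.trans hy.symm) (IsOpen.mem_nhds hV ?_)
    change Y.atlas y ∈ V
    rw [hy]; exact hx
  have h3 := (ContMDiff.continuous hφ).continuousAt.preimage_mem_nhds h2
  have : π₁ ⁻¹' (f ⁻¹' V) = φ ⁻¹' (π₂ ⁻¹' V) := by
    rw [← Set.preimage_comp, ← Set.preimage_comp, hcomp]
  rw [this]; exact h3

/-! ### `Q`-groups and `Q`-principal bundles -/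

/-- A group with a `Q`-manifold structure is a `Q`-group when multiplication and inversion are
`Q`-smooth. -/
structure IsQGroup {G : Type u} [Group G] (X : QManifold F G) : Prop where
  smooth_mul : IsQSmooth (X.prod X) X (fun x => x.1 * x.2)
  smooth_inv : IsQSmooth X X (fun x => x⁻¹)

/-- A `Q`-manifold `total` with a free right `Q`-smooth action of the `Q`-group `G` and a
`Q`-smooth map to the smooth manifold `N`. -/
structure QActionOver {G : Type u} [Group G] (XG : QManifold F G) (N : SmoothMfd.{u} E)
    (D : Type) [NormedAddCommGroup D] [NormedSpace ℝ D] [FiniteDimensional ℝ D] :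
    Type (u + 1) where
  total : Type u
  str : QManifold D total
  act : total → G → total
  act_one : ∀ p, act p 1 = p
  act_mul : ∀ p g h, act p (g * h) = act (act p g) h
  act_free : ∀ p g, act p g = p → g = 1
  act_smooth : IsQSmooth (str.prod XG) str (fun x => act x.1 x.2)
  proj : total → N
  proj_smooth : IsQSmooth str (QManifold.ofManifold N) proj

section Bundles

variable {G : Type u} [Group G] {XG : QManifold F G} {N : SmoothMfd.{u} E}
  {D : Type} [NormedAddCommGroup D] [NormedSpace ℝ D] [FiniteDimensional ℝ D]

/-- The open `Q`-submanifold `β⁻¹(U)` of the total space. -/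
noncomputable def QActionOver.over (B : QActionOver XG N D) (U : Opens N) : QManifold D (B.proj ⁻¹' U) :=
  B.str.restrict _ (B.proj_smooth.isOpenSet_preimage U.isOpen)

/-- A `G`-equivariant `Q`-diffeomorphism `ψ : β⁻¹(U) → U × G` with `pr₁ ∘ ψ = β`. -/
structure LocalTriv (B : QActionOver XG N D) (U : Opens N) where
  toEquiv : (B.proj ⁻¹' (U : Set N) : Set B.total) ≃ (N.opens U) × G
  smooth : IsQSmooth (B.over U) ((QManifold.ofManifold (N.opens U)).prod XG) toEquiv
  smooth_symm : IsQSmooth ((QManifold.ofManifold (N.opens U)).prod XG) (B.over U) toEquiv.symm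
  fst_eq : ∀ p, ((toEquiv p).1 : N) = B.proj p
  equivariant : ∀ p q : (B.proj ⁻¹' (U : Set N) : Set B.total), ∀ g : G,
    (q : B.total) = B.act p g → toEquiv q = ((toEquiv p).1, (toEquiv p).2 * g)

/-- A `Q`-principal bundle over `N` with structure group `G`. -/
structure QPrincipalBundle {G : Type u} [Group G] (XG : QManifold F G) (N : SmoothMfd.{u} E)
    (D : Type) [NormedAddCommGroup D] [NormedSpace ℝ D] [FiniteDimensional ℝ D]
    extends QActionOver XG N D where
  fiber_eq : ∀ p, proj ⁻¹' {proj p} = Set.range (act p)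
  locally_trivial : ∀ n : N, ∃ U : Opens N, n ∈ U ∧ Nonempty (LocalTriv toQActionOver U)

/-- `ψ : U ∩ V → G` is the transition function from the local trivialization `e` over `U` to
the local trivialization `e'` over `V`: if `e = (β, φ)` and `e' = (β, φ')`, then
`ψ (β p) = φ' p * (φ p)⁻¹`. -/
def IsTransitionFunction {B : QActionOver XG N D} {U V : Opens N} (e : LocalTriv B U)
    (e' : LocalTriv B V) (ψ : N.opens (V ⊓ U) → G) : Prop :=
  ∀ (p : B.total) (hU : B.proj p ∈ U) (hV : B.proj p ∈ V),
    ψ ⟨B.proj p, hV, hU⟩ = (e'.toEquiv ⟨p, hV⟩).2 * ((e.toEquiv ⟨p, hU⟩).2)⁻¹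

/-- A family of `G`-valued transition functions `ψ j i : U j ∩ U i → G` with respect to the
family of open sets `U`. -/
structure IsTransitionFamily {I : Type u} (XG : QManifold F G) (U : I → Opens N)
    (ψ : ∀ j i : I, N.opens (U j ⊓ U i) → G) : Prop where
  smooth : ∀ j i, IsQSmooth (QManifold.ofManifold (N.opens (U j ⊓ U i))) XG (ψ j i)
  cocycle : ∀ (i j k : I) (n : N) (hi : n ∈ U i) (hj : n ∈ U j) (hk : n ∈ U k),
    ψ k i ⟨n, hk, hi⟩ = ψ k j ⟨n, hk, hj⟩ * ψ j i ⟨n, hj, hi⟩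

/-- For a map `q : M → G` and local trivializations `e i` over `U i`, the map
`⊔ᵢ U i × M → P`, `(i, n, m) ↦ (e i)⁻¹ (n, q m)`. -/
def gluingMap {I : Type u} {B : QActionOver XG N D} {U : I → Opens N}
    (e : ∀ i, LocalTriv B (U i)) {M : SmoothMfd.{u} F} (q : M → G) :
    SmoothMfd.sigma (fun i => (N.opens (U i)).prod M) → B.total :=
  fun x => ((e x.1).toEquiv.symm (x.2.1, q x.2.2) : B.total)

end Bundles

end Constructions

end QGeom

/-! As a bare set the total space is `N × G`: every `n` is given some index `c n` with `n ∈ U (c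
n)`, with no regularity in `n`, and the fibre over `n` is identified with `G` through the
trivialization of index `c n`. The trivialization of index `i` is then left multiplication by `ψ i
(c n)` on that fibre. No quotient is formed: the gluing relation and the transition functions follow
from the cocycle identity, and left multiplication commutes with the right action. What remains is
regularity, that is, to show that the map from the disjoint union of the `U i × M` to `N × G` is a
`Q`-chart.

Being a `Q`-chart is a property of germs. By `isQChart_of_germs` it suffices that the map lifts
smoothly through itself between any two points with the same image (`LiftAt`), and that it separates
smooth germs (`SepAt`). Equivalence of charts and `Q`-smoothness have the same description
(`qChartEquiv_of_germs`, `isQSmooth_of_liftAt`). Germs are required to be smooth on a neighbourhood,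
because being `C^∞` at a point is not an open condition.

For the glued map, separation holds because on each piece it is `id × q` followed by an injection.
Lifting reduces to `liftAt_transition`: the map `(n, m) ↦ ψ j i n * q m` lifts through any chart
`q'` of `G`, with any admissible value, since `ψ j i` and multiplication are `Q`-smooth. Allowing
`q' ≠ q` shows that all atlases of `G` induce atlases of the same `Q`-manifold. -/

namespace QGeom

open Filter Topology

/-! ### Germs of smooth maps and their lifts through `Q`-charts. -/

section GermCalculus

variable {E : Type} [NormedAddCommGroup E] [NormedSpace ℝ E] [FiniteDimensional ℝ E]
variable {F : Type} [NormedAddCommGroup F] [NormedSpace ℝ F] [FiniteDimensional ℝ F]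
variable {E' : Type} [NormedAddCommGroup E'] [NormedSpace ℝ E'] [FiniteDimensional ℝ E']
variable {F' : Type} [NormedAddCommGroup F'] [NormedSpace ℝ F'] [FiniteDimensional ℝ F']
variable {M M' : SmoothMfd.{u} E} {N : SmoothMfd.{u} F} {K : SmoothMfd.{u} E'}
  {L : SmoothMfd.{u} F'}

/-! ### Germs of smooth maps -/

/-- `f` is smooth on a neighbourhood of `x`. -/
def SmoothNear (f : M → N) (x : M) : Prop :=
  ∀ᶠ z in 𝓝 x, ContMDiffAt 𝓘(ℝ, E) 𝓘(ℝ, F) ∞ f z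

theorem SmoothMfd.Smooth.smoothNear {f : M → N} (hf : SmoothMfd.Smooth f) (x : M) :
    SmoothNear f x :=
  Eventually.of_forall fun _ => ContMDiff.contMDiffAt hf

theorem SmoothNear.continuousAt {f : M → N} {x : M} (hf : SmoothNear f x) : ContinuousAt f x :=
  hf.self_of_nhds.continuousAt

theorem SmoothNear.comp {g : N → K} {f : M → N} {x : M} (hg : SmoothNear g (f x))
    (hf : SmoothNear f x) : SmoothNear (fun z => g (f z)) x := by
  filter_upwards [hf, hf.continuousAt.eventually hg] with z hz hz'
  exact ContMDiffAt.comp z hz' hz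

theorem SmoothNear.comp_of_eq {g : N → K} {f : M → N} {x : M} {y : N} (hg : SmoothNear g y)
    (hf : SmoothNear f x) (h : f x = y) : SmoothNear (fun z => g (f z)) x :=
  SmoothNear.comp (h ▸ hg) hf

theorem SmoothNear.congr {f g : M → N} {x : M} (hf : SmoothNear f x)
    (h : ∀ᶠ z in 𝓝 x, g z = f z) : SmoothNear g x := by
  filter_upwards [hf, h.eventually_nhds] with z hz hz'
  exact hz.congr_of_eventuallyEq hz'

theorem SmoothMfd.smooth_id (M : SmoothMfd.{u} E) :
    SmoothMfd.Smooth (M := M) (N := M) fun z => z :=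
  contMDiff_id

theorem SmoothMfd.smooth_fst : SmoothMfd.Smooth (M := M.prod N) (N := M) Prod.fst :=
  ((SmoothMfd.smooth_prod_iff (T := M.prod N) (M := M) (N := N) _).1
    (SmoothMfd.smooth_id (M.prod N))).1

theorem SmoothMfd.smooth_snd : SmoothMfd.Smooth (M := M.prod N) (N := N) Prod.snd :=
  ((SmoothMfd.smooth_prod_iff (T := M.prod N) (M := M) (N := N) _).1
    (SmoothMfd.smooth_id (M.prod N))).2

theorem SmoothNear.prodMk {f : K → M} {g : K → N} {x : K} (hf : SmoothNear f x)
    (hg : SmoothNear g x) : SmoothNear (N := M.prod N) (fun z => (f z, g z)) x := by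
  filter_upwards [hf, hg] with z hz hz'
  rw [modelWithCornersSelf_prod]
  exact ContMDiffAt.prodMk (I' := 𝓘(ℝ, E)) (J' := 𝓘(ℝ, F)) hz hz'

theorem SmoothMfd.smooth_subtypeVal (W : Opens M) :
    SmoothMfd.Smooth (M := M.opens W) (N := M) Subtype.val :=
  contMDiff_subtype_val

theorem SmoothNear.of_subtypeVal_comp {W : Opens N} {f : M → N.opens W} {x : M}
    (hf : SmoothNear (N := N) (fun z => (f z : N)) x) : SmoothNear f x := by
  filter_upwards [hf] with z hz
  exact (ContMDiffAt.subtypeVal_comp_iff W f z).1 hz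

/-- A smooth germ restricts to a smooth map on an open submanifold. -/
theorem SmoothMfd.smooth_restrict {W : Opens M} {f : M → N}
    (hf : ∀ z ∈ W, ContMDiffAt 𝓘(ℝ, E) 𝓘(ℝ, F) ∞ f z) :
    SmoothMfd.Smooth (M := M.opens W) (N := N) (fun z => f z.1) :=
  fun z => ContMDiffAt.comp z (hf z.1 z.2) contMDiff_subtype_val.contMDiffAt

/-! ### Étale maps -/

/-- `j` is a local diffeomorphism at `x`: it is smooth and has a smooth two-sided local inverse. -/
def IsEtaleAt (j : M → M') (x : M) : Prop :=
  SmoothNear j x ∧ ∃ k : M' → M, SmoothNear k (j x) ∧ (∀ᶠ z in 𝓝 x, k (j z) = z) ∧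
    ∀ᶠ z in 𝓝 (j x), j (k z) = z

/-- In the preferred charts `e` at `x` and `e'` at `j x` the map `j` reads as the identity, so near
`x` it is `e'.symm ∘ e`, with local inverse `e.symm ∘ e'`. Inclusions into disjoint unions have this
form. -/
theorem isEtaleAt_of_chartAt_eq_lift {j : M → M'} (hj : IsOpenEmbedding j) (x : M)
    (h : chartAt E (j x) = (chartAt E x).lift_openEmbedding hj) : IsEtaleAt j x := by
  set e := chartAt E x with he
  set e' := chartAt E (j x) with he'
  have hx : x ∈ e.source := mem_chart_source E x
  have hx' : j x ∈ e'.source := mem_chart_source E (j x)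
  have happ : ∀ z, e' (j z) = e z := fun z => by
    rw [h]; exact e.lift_openEmbedding_apply hj
  have hsymm : ∀ z, e'.symm z = j (e.symm z) := fun z => by
    rw [h]; rfl
  have hsrc : e'.source = j '' e.source := by rw [h]; rfl
  have htgt : e'.target = e.target := by rw [h]; rfl
  have hjs : ∀ z ∈ e.source, j z = e'.symm (e z) := fun z hz => by
    rw [hsymm, e.left_inv hz]
  have se : ∀ z ∈ e.source, ContMDiffAt 𝓘(ℝ, E) 𝓘(ℝ, E) ∞ e z := fun z hz =>
    (contMDiffOn_chart (I := 𝓘(ℝ, E)) (n := ∞) (x := x)).contMDiffAt (e.open_source.mem_nhds hz)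
  have se' : ∀ z ∈ e'.source, ContMDiffAt 𝓘(ℝ, E) 𝓘(ℝ, E) ∞ e' z := fun z hz =>
    (contMDiffOn_chart (I := 𝓘(ℝ, E)) (n := ∞) (x := j x)).contMDiffAt
      (e'.open_source.mem_nhds hz)
  have ses : ∀ z ∈ e.target, ContMDiffAt 𝓘(ℝ, E) 𝓘(ℝ, E) ∞ e.symm z := fun z hz =>
    (contMDiffOn_chart_symm (I := 𝓘(ℝ, E)) (n := ∞) (x := x)).contMDiffAt
      (e.open_target.mem_nhds hz)
  have ses' : ∀ z ∈ e'.target, ContMDiffAt 𝓘(ℝ, E) 𝓘(ℝ, E) ∞ e'.symm z := fun z hz =>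
    (contMDiffOn_chart_symm (I := 𝓘(ℝ, E)) (n := ∞) (x := j x)).contMDiffAt
      (e'.open_target.mem_nhds hz)
  refine ⟨?_, fun z => e.symm (e' z), ?_, ?_, ?_⟩
  · filter_upwards [e.open_source.mem_nhds hx] with z hz
    have h1 : ContMDiffAt 𝓘(ℝ, E) 𝓘(ℝ, E) ∞ (fun w => e'.symm (e w)) z :=
      ContMDiffAt.comp z (ses' _ (htgt ▸ e.map_source hz)) (se z hz)
    refine h1.congr_of_eventuallyEq ?_
    filter_upwards [e.open_source.mem_nhds hz] with w hw using hjs w hw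
  · filter_upwards [e'.open_source.mem_nhds hx'] with z hz
    exact ContMDiffAt.comp z (ses _ (htgt ▸ e'.map_source hz)) (se' z hz)
  · filter_upwards [e.open_source.mem_nhds hx] with z hz
    rw [happ, e.left_inv hz]
  · filter_upwards [e'.open_source.mem_nhds hx'] with z hz
    rw [← hsymm, e'.left_inv hz]

theorem isEtaleAt_inl (x : M) : IsEtaleAt (M' := M.sum M') Sum.inl x :=
  isEtaleAt_of_chartAt_eq_lift (M' := M.sum M') IsOpenEmbedding.inl x
    (ChartedSpace.sum_chartAt_inl (M := M) (M' := M') x)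

theorem isEtaleAt_inr (x : M') : IsEtaleAt (M' := M.sum M') Sum.inr x :=
  isEtaleAt_of_chartAt_eq_lift (M' := M.sum M') IsOpenEmbedding.inr x
    (ChartedSpace.sum_chartAt_inr (M := M) (M' := M') x)

theorem isEtaleAt_sigmaMk {ι : Type u} {X : ι → SmoothMfd.{u} E} (i : ι) (x : X i) :
    IsEtaleAt (M' := SmoothMfd.sigma X) (fun z => ⟨i, z⟩) x :=
  isEtaleAt_of_chartAt_eq_lift (M' := SmoothMfd.sigma X)
    (IsOpenEmbedding.sigmaMk (σ := fun i => X i) (i := i)) x rfl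

theorem isEtaleAt_subtypeVal {W : Opens M} (x : M.opens W) :
    IsEtaleAt (M := M.opens W) (M' := M) Subtype.val x := by
  classical
  have hW : ∀ᶠ z in 𝓝 (x : M), z ∈ W := W.isOpen.mem_nhds x.2
  have hk : ∀ z : M, z ∈ W → ((if h : z ∈ W then ⟨z, h⟩ else x : W) : M) = z := fun z hz => by
    rw [dif_pos hz]
  -- The value `x` outside `W` is arbitrary: only the germ of the inverse matters.
  refine ⟨(SmoothMfd.smooth_subtypeVal W).smoothNear x, fun z => if h : z ∈ W then ⟨z, h⟩ else x,
    ?_, Eventually.of_forall fun z => Subtype.ext (hk z z.2), hW.mono hk⟩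
  refine SmoothNear.of_subtypeVal_comp ?_
  exact ((SmoothMfd.smooth_id M).smoothNear _).congr (hW.mono hk)

/-! ### Local lifts -/

/-- Near `x` the map `a` factors as `b ∘ φ` with `φ` smooth and `φ x = y`. -/
def LiftAt {S : Type*} (a : M → S) (b : N → S) (x : M) (y : N) : Prop :=
  ∃ φ : M → N, φ x = y ∧ SmoothNear φ x ∧ ∀ᶠ z in 𝓝 x, b (φ z) = a z

section LiftAt

variable {S R : Type*}

theorem LiftAt.of_smoothNear {a : M → S} {b : N → S} {x : M} {φ : M → N} (hφ : SmoothNear φ x)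
    (h : ∀ z, b (φ z) = a z) : LiftAt a b x (φ x) :=
  ⟨φ, rfl, hφ, Eventually.of_forall h⟩

theorem LiftAt.refl (a : M → S) (x : M) : LiftAt a a x x :=
  LiftAt.of_smoothNear ((SmoothMfd.smooth_id M).smoothNear x) fun _ => rfl

theorem LiftAt.congr_left {a a' : M → S} {b : N → S} {x : M} {y : N} (h : LiftAt a b x y)
    (e : ∀ z, a z = a' z) : LiftAt a' b x y :=
  (funext e : a = a') ▸ h

theorem LiftAt.trans {a : M → S} {b : N → S} {c : K → S} {x : M} {y : N} {z : K}
    (h₁ : LiftAt a b x y) (h₂ : LiftAt b c y z) : LiftAt a c x z := by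
  obtain ⟨φ, rfl, hφ, h₁⟩ := h₁
  obtain ⟨χ, rfl, hχ, h₂⟩ := h₂
  refine ⟨fun w => χ (φ w), rfl, hχ.comp hφ, ?_⟩
  filter_upwards [h₁, hφ.continuousAt.eventually h₂] with w hw hw'
  rw [hw', hw]

theorem LiftAt.post {a : M → S} {b : N → S} {x : M} {y : N} (h : LiftAt a b x y) (f : S → R) :
    LiftAt (fun z => f (a z)) (fun z => f (b z)) x y := by
  obtain ⟨φ, hxy, hφ, h⟩ := h
  exact ⟨φ, hxy, hφ, h.mono fun z hz => congrArg f hz⟩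

theorem LiftAt.of_post {a : M → S} {b : N → S} {x : M} {y : N} {f : S → R}
    (hf : Function.Injective f) (h : LiftAt (fun z => f (a z)) (fun z => f (b z)) x y) :
    LiftAt a b x y := by
  obtain ⟨φ, hxy, hφ, h⟩ := h
  exact ⟨φ, hxy, hφ, h.mono fun z hz => hf hz⟩

theorem LiftAt.pre {a : M → S} {b : N → S} {y : N} {f : K → M} {w : K}
    (h : LiftAt a b (f w) y) (hf : SmoothNear f w) : LiftAt (fun z => a (f z)) b w y := by
  obtain ⟨φ, hxy, hφ, h⟩ := h
  exact ⟨fun z => φ (f z), hxy, hφ.comp hf, hf.continuousAt.eventually h⟩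

theorem LiftAt.prodMk {a : K → S} {b : M → S} {a' : K → R} {b' : N → R} {x : K} {y : M} {y' : N}
    (h : LiftAt a b x y) (h' : LiftAt a' b' x y') :
    LiftAt (N := M.prod N) (fun z => (a z, a' z)) (Prod.map b b') x (y, y') := by
  obtain ⟨φ, rfl, hφ, h⟩ := h
  obtain ⟨χ, rfl, hχ, h'⟩ := h'
  refine ⟨fun z => (φ z, χ z), rfl, hφ.prodMk hχ, ?_⟩
  filter_upwards [h, h'] with z hz hz'
  exact Prod.ext hz hz'

theorem LiftAt.prodMap {a : K → S} {b : M → S} {a' : L → R} {b' : N → R} {x : K} {x' : L}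
    {y : M} {y' : N} (h : LiftAt a b x y) (h' : LiftAt a' b' x' y') :
    LiftAt (M := K.prod L) (N := M.prod N) (Prod.map a a') (Prod.map b b') (x, x') (y, y') :=
  LiftAt.prodMk (K := K.prod L)
    (LiftAt.pre (K := K.prod L) (f := Prod.fst) (w := (x, x')) h (SmoothMfd.smooth_fst.smoothNear _))
    (LiftAt.pre (K := K.prod L) (f := Prod.snd) (w := (x, x')) h' (SmoothMfd.smooth_snd.smoothNear _))

theorem IsEtaleAt.liftAt {j : M → M'} {x : M} (hj : IsEtaleAt j x) (a : M' → S) :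
    LiftAt (fun z => a (j z)) a x (j x) :=
  LiftAt.of_smoothNear hj.1 fun _ => rfl

theorem IsEtaleAt.liftAt_symm {j : M → M'} {x : M} (hj : IsEtaleAt j x) (a : M' → S) :
    LiftAt a (fun z => a (j z)) (j x) x := by
  obtain ⟨-, k, hk, hl, hr⟩ := hj
  exact ⟨k, hl.self_of_nhds, hk, hr.mono fun z hz => congrArg a hz⟩

/-- Smooth germs at a point with value `x` are determined by their composition with `a`. -/
def SepAt (a : M → S) (x : M) : Prop :=
  ∀ (D : Type) [NormedAddCommGroup D] [NormedSpace ℝ D] [FiniteDimensional ℝ D]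
    (T : SmoothMfd.{u} D) (f g : T → M) (t : T), SmoothNear f t → SmoothNear g t → f t = x →
    g t = x → (∀ᶠ s in 𝓝 t, a (f s) = a (g s)) → ∀ᶠ s in 𝓝 t, f s = g s

theorem sepAt_id (x : M) : SepAt (fun z : M => z) x :=
  fun _ _ _ _ _ _ _ _ _ _ _ _ h => h

theorem SepAt.post {a : M → S} {x : M} (h : SepAt a x) {f : S → R} (hf : Function.Injective f) :
    SepAt (fun z => f (a z)) x :=
  fun D _ _ _ T p q t hp hq hpx hqx e => h D T p q t hp hq hpx hqx (e.mono fun _ hs => hf hs)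

theorem SepAt.prodMap {a : M → S} {b : N → R} {x : M} {y : N} (ha : SepAt a x) (hb : SepAt b y) :
    SepAt (M := M.prod N) (Prod.map a b) (x, y) := by
  intro D _ _ _ T p q t hp hq hpx hqx e
  have fst : ∀ {f : T → M.prod N}, SmoothNear f t → SmoothNear (fun s => (f s).1) t :=
    fun hf => SmoothNear.comp (SmoothMfd.smooth_fst.smoothNear _) hf
  have snd : ∀ {f : T → M.prod N}, SmoothNear f t → SmoothNear (fun s => (f s).2) t :=
    fun hf => SmoothNear.comp (SmoothMfd.smooth_snd.smoothNear _) hf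
  filter_upwards [
    ha D T _ _ t (fst hp) (fst hq) (congrArg Prod.fst hpx) (congrArg Prod.fst hqx)
      (e.mono fun s hs => congrArg Prod.fst hs),
    hb D T _ _ t (snd hp) (snd hq) (congrArg Prod.snd hpx) (congrArg Prod.snd hqx)
      (e.mono fun s hs => congrArg Prod.snd hs)] with s h₁ h₂
  exact Prod.ext h₁ h₂

/-- Both germs start at `j x`, so by continuity they stay where `j ∘ k = id`; composing them with
the local inverse `k` moves the question to `x`. -/
theorem SepAt.of_etale {j : M → M'} {x : M} (hj : IsEtaleAt j x) {a : M' → S}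
    (h : SepAt (fun z => a (j z)) x) : SepAt a (j x) := by
  obtain ⟨-, k, hk, hl, hr⟩ := hj
  intro D _ _ _ T p q t hp hq hpx hqx e
  have rp := (hpx ▸ hp.continuousAt : Tendsto p (𝓝 t) (𝓝 (j x))).eventually hr
  have rq := (hqx ▸ hq.continuousAt : Tendsto q (𝓝 t) (𝓝 (j x))).eventually hr
  have := h D T (fun s => k (p s)) (fun s => k (q s)) t (hk.comp_of_eq hp hpx)
    (hk.comp_of_eq hq hqx) (by rw [hpx]; exact hl.self_of_nhds)
    (by rw [hqx]; exact hl.self_of_nhds) (by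
      filter_upwards [e, rp, rq] with s h₁ h₂ h₃
      rw [h₂, h₃, h₁])
  filter_upwards [this, rp, rq] with s h₁ h₂ h₃
  rw [← h₂, ← h₃, h₁]

theorem SepAt.comp_etale {j : M → M'} {x : M} (hj : IsEtaleAt j x) {a : M' → S}
    (h : SepAt a (j x)) : SepAt (fun z => a (j z)) x := by
  obtain ⟨hs, k, hk, hl, hr⟩ := hj
  intro D _ _ _ T p q t hp hq hpx hqx e
  have rp := (hpx ▸ hp.continuousAt : Tendsto p (𝓝 t) (𝓝 x)).eventually hl
  have rq := (hqx ▸ hq.continuousAt : Tendsto q (𝓝 t) (𝓝 x)).eventually hl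
  have := h D T (fun s => j (p s)) (fun s => j (q s)) t (hs.comp_of_eq hp hpx)
    (hs.comp_of_eq hq hqx) (congrArg j hpx) (congrArg j hqx) e
  filter_upwards [this, rp, rq] with s h₁ h₂ h₃
  rw [← h₂, ← h₃, h₁]

end LiftAt

/-! ### `Q`-charts and `Q`-smooth maps in terms of germs -/

section QCharts

variable {S R : Type u}

theorem IsQChart.liftAt {π : M → S} (h : IsQChart π) {x y : M} (hxy : π x = π y) :
    LiftAt π π x y := by
  obtain ⟨k, hx, hkx, hs, -, hπ⟩ := h.transverse x y hxy
  refine ⟨k, hkx, ?_, ?_⟩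
  · filter_upwards [k.open_source.mem_nhds hx] with z hz
    exact hs.contMDiffAt (k.open_source.mem_nhds hz)
  · filter_upwards [k.open_source.mem_nhds hx] with z hz using hπ z hz

/-- Condition (b) is about globally defined smooth maps; it is applied on an open submanifold of `T`
where both germs are smooth and agree after `π`. -/
theorem IsQChart.sepAt {π : M → S} (h : IsQChart π) (x : M) : SepAt π x := by
  intro D _ _ _ T f g t hf hg hfx hgx e
  obtain ⟨W, hW, hWo, htW⟩ := eventually_nhds_iff.1 ((hf.and hg).and e)
  let W' : Opens T := ⟨W, hWo⟩
  have h1 : IsOpen {s : T.opens W' | f s.1 = g s.1} :=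
    h.isOpen_eq D (T.opens W') (fun s => f s.1) (fun s => g s.1)
      (SmoothMfd.smooth_restrict (W := W') fun z hz => (hW z hz).1.1)
      (SmoothMfd.smooth_restrict (W := W') fun z hz => (hW z hz).1.2)
      (funext fun s => (hW s.1 s.2).2)
  have h2 := hWo.isOpenMap_subtype_val _ h1
  refine mem_of_superset (h2.mem_nhds ⟨⟨t, htW⟩, hfx.trans hgx.symm, rfl⟩) ?_
  rintro _ ⟨s, hs, rfl⟩
  exact hs

/-- Lifts `φ` from `x` to `y` and `χ` back need not be inverse by choice, but `χ ∘ φ` and the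
identity are germs at `x` with the same composition with `π`, so separation makes them equal;
likewise for `φ ∘ χ`. Hence `φ` is a local diffeomorphism. -/
theorem isQChart_of_germs {π : M → S} (hl : ∀ x y, π x = π y → LiftAt π π x y)
    (hs : ∀ x, SepAt π x) : IsQChart π where
  transverse x y hxy := by
    obtain ⟨φ, rfl, hφ, hφπ⟩ := hl x y hxy
    obtain ⟨χ, hχx, hχ, hχπ⟩ := hl (φ x) x hxy.symm
    have smooth_id := (SmoothMfd.smooth_id M).smoothNear
    have tχ : Tendsto χ (𝓝 (φ x)) (𝓝 x) := by
      have := hχ.continuousAt.tendsto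
      rwa [hχx] at this
    have e₁ : ∀ᶠ z in 𝓝 x, χ (φ z) = z := by
      refine hs x E M (fun z => χ (φ z)) (fun z => z) x (hχ.comp hφ) (smooth_id x) hχx rfl ?_
      filter_upwards [hφπ, hφ.continuousAt.eventually hχπ] with z h₁ h₂
      rw [h₂, h₁]
    have e₂ : ∀ᶠ z in 𝓝 (φ x), φ (χ z) = z := by
      refine hs (φ x) E M (fun z => φ (χ z)) (fun z => z) (φ x) (hφ.comp_of_eq hχ hχx)
        (smooth_id _) (congrArg φ hχx) rfl ?_
      filter_upwards [hχπ, tχ.eventually hφπ] with z h₁ h₂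
      rw [h₂, h₁]
    obtain ⟨A, hA, hAo, hxA⟩ := eventually_nhds_iff.1 ((e₁.and hφ).and hφπ)
    obtain ⟨B, hB, hBo, hxB⟩ := eventually_nhds_iff.1 (e₂.and hχ)
    have cφ : ContinuousOn φ A := fun z hz => (hA z hz).1.2.continuousAt.continuousWithinAt
    have cχ : ContinuousOn χ B := fun z hz => (hB z hz).2.continuousAt.continuousWithinAt
    -- `χ ∘ φ = id` on `A` and `φ ∘ χ = id` on `B`; cutting each by the preimage of the other makes
    -- `φ` and `χ` exchange source and target.
    refine ⟨{ toFun := φ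
              invFun := χ
              source := A ∩ φ ⁻¹' B
              target := B ∩ χ ⁻¹' A
              map_source' := fun z hz => ⟨hz.2, ?_⟩
              map_target' := fun z hz => ⟨hz.2, ?_⟩
              left_inv' := fun z hz => (hA z hz.1).1.1
              right_inv' := fun z hz => (hB z hz.1).1
              open_source := cφ.isOpen_inter_preimage hAo hBo
              open_target := cχ.isOpen_inter_preimage hBo hAo
              continuousOn_toFun := cφ.mono Set.inter_subset_left
              continuousOn_invFun := cχ.mono Set.inter_subset_left },
      ⟨hxA, hxB⟩, rfl, fun z hz => (hA z hz.1).1.2.contMDiffWithinAt,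
      fun z hz => (hB z hz.1).2.contMDiffWithinAt, fun z hz => (hA z hz.1).2⟩
    · change χ (φ z) ∈ A
      rw [(hA z hz.1).1.1]; exact hz.1
    · change φ (χ z) ∈ B
      rw [(hB z hz.1).1]; exact hz.1
  isOpen_eq D _ _ _ T f g hf hg hfg := by
    refine isOpen_iff_mem_nhds.2 fun t ht => ?_
    exact hs (g t) D T f g t (hf.smoothNear t) (hg.smoothNear t) ht rfl
      (Eventually.of_forall fun s => congrFun hfg s)

/-- The inclusions of the two pieces are étale, so lifts are checked piece against piece, and
separation within one piece. -/
theorem qChartEquiv_of_germs {M₁ M₂ : SmoothMfd.{u} E} {π₁ : M₁ → S} {π₂ : M₂ → S}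
    (h₁ : IsQChart π₁) (h₂ : IsQChart π₂) (h₁₂ : ∀ x y, π₁ x = π₂ y → LiftAt π₁ π₂ x y)
    (h₂₁ : ∀ x y, π₂ x = π₁ y → LiftAt π₂ π₁ x y) : QChartEquiv π₁ π₂ := by
  have l₁ := fun x : M₁ => (isEtaleAt_inl (M' := M₂) x).liftAt (sumMap π₁ π₂)
  have l₂ := fun x : M₂ => (isEtaleAt_inr (M := M₁) x).liftAt (sumMap π₁ π₂)
  have s₁ := fun x : M₁ => (isEtaleAt_inl (M' := M₂) x).liftAt_symm (sumMap π₁ π₂)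
  have s₂ := fun x : M₂ => (isEtaleAt_inr (M := M₁) x).liftAt_symm (sumMap π₁ π₂)
  apply isQChart_of_germs
  · rintro (x | x) (y | y) hxy
    · exact (s₁ x).trans ((h₁.liftAt hxy).trans (l₁ y))
    · exact (s₁ x).trans ((h₁₂ x y hxy).trans (l₂ y))
    · exact (s₂ x).trans ((h₂₁ x y hxy).trans (l₁ y))
    · exact (s₂ x).trans ((h₂.liftAt hxy).trans (l₂ y))
  · rintro (x | x)
    · exact SepAt.of_etale (isEtaleAt_inl (M' := M₂) x) (a := sumMap π₁ π₂) (h₁.sepAt x)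
    · exact SepAt.of_etale (isEtaleAt_inr (M := M₁) x) (a := sumMap π₁ π₂) (h₂.sepAt x)

theorem QChartEquiv.liftAt {M₁ M₂ : SmoothMfd.{u} E} {π₁ : M₁ → S} {π₂ : M₂ → S}
    (h : QChartEquiv π₁ π₂) {x : M₁} {y : M₂} (hxy : π₁ x = π₂ y) : LiftAt π₁ π₂ x y :=
  ((isEtaleAt_inl (M' := M₂) x).liftAt (sumMap π₁ π₂)).trans
    ((IsQChart.liftAt h (x := Sum.inl x) (y := Sum.inr y) hxy).trans
      ((isEtaleAt_inr (M := M₁) y).liftAt_symm (sumMap π₁ π₂)))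

theorem QChartEquiv.liftAt_symm {M₁ M₂ : SmoothMfd.{u} E} {π₁ : M₁ → S} {π₂ : M₂ → S}
    (h : QChartEquiv π₁ π₂) {x : M₁} {y : M₂} (hxy : π₁ x = π₂ y) : LiftAt π₂ π₁ y x :=
  ((isEtaleAt_inr (M := M₁) y).liftAt (sumMap π₁ π₂)).trans
    ((IsQChart.liftAt h (x := Sum.inr y) (y := Sum.inl x) hxy.symm).trans
      ((isEtaleAt_inl (M' := M₂) x).liftAt_symm (sumMap π₁ π₂)))

theorem QManifold.isChart_atlas (X : QManifold E S) : X.IsChart X.atlas :=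
  ⟨X.isQChart, qChartEquiv_of_germs X.isQChart X.isQChart (fun _ _ h => X.isQChart.liftAt h)
    fun _ _ h => X.isQChart.liftAt h⟩

/-- `IsQSmooth` asks for a lift defined on a whole chart domain; shrinking the domain turns a germ
of a lift into such a lift. -/
theorem QManifold.isChart_restrict (X : QManifold E S) (W : Opens X.dom) :
    X.IsChart (M := X.dom.opens W) (fun z => X.atlas z.1) := by
  have l := fun x : X.dom.opens W => (isEtaleAt_subtypeVal x).liftAt X.atlas
  have s := fun x : X.dom.opens W => (isEtaleAt_subtypeVal x).liftAt_symm X.atlas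
  have h : IsQChart (M := X.dom.opens W) (fun z => X.atlas z.1) :=
    isQChart_of_germs
      (fun x y hxy => (l x).trans ((X.isQChart.liftAt hxy).trans (s y)))
      (fun x => SepAt.comp_etale (isEtaleAt_subtypeVal x) (X.isQChart.sepAt x.1))
  exact ⟨h, qChartEquiv_of_germs h X.isQChart
    (fun x y hxy => (l x).trans (X.isQChart.liftAt hxy))
    fun x y hxy => (X.isQChart.liftAt hxy).trans (s y)⟩

/-- Two charts are compared through a point of the atlas over the common value, which exists because
the atlas is surjective. -/
theorem QManifold.IsChart.liftAt {X : QManifold E S} {π : M → S} {π' : M' → S}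
    (h : X.IsChart π) (h' : X.IsChart π') {x : M} {y : M'} (hxy : π x = π' y) :
    LiftAt π π' x y := by
  obtain ⟨z, hz⟩ := X.surjective (π x)
  exact (h.2.liftAt hz.symm).trans (h'.2.liftAt_symm (hxy.symm.trans hz.symm))

/-- The definition supplies a lift for some charts and base points only; changes of chart on both
sides carry it to arbitrary ones. -/
theorem IsQSmooth.liftAt {X : QManifold E S} {Y : QManifold F R} {f : S → R}
    (hf : IsQSmooth X Y f) {π : M → S} {π' : N → R} (hπ : X.IsChart π) (hπ' : Y.IsChart π')
    {x : M} {y : N} (hxy : f (π x) = π' y) : LiftAt (fun z => f (π z)) π' x y := by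
  obtain ⟨M₁, M₂, π₁, π₂, φ, m, h₁, h₂, hφ, hm, hc⟩ := hf (π x)
  have hc' : ∀ z, π₂ (φ z) = f (π₁ z) := fun z => (congrFun hc z).symm
  have key : LiftAt (fun z => f (π₁ z)) π₂ m (φ m) :=
    LiftAt.of_smoothNear (hφ.smoothNear m) hc'
  refine ((hπ.liftAt h₁ hm.symm).post f).trans (key.trans (h₂.liftAt hπ' ?_))
  rw [hc', hm, hxy]

theorem isQSmooth_of_liftAt {X : QManifold E S} {Y : QManifold F R} {f : S → R}
    (h : ∀ s, ∃ x y, X.atlas x = s ∧ LiftAt (fun z => f (X.atlas z)) Y.atlas x y) :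
    IsQSmooth X Y f := by
  intro s
  obtain ⟨x, y, hx, φ, rfl, hφ, hφπ⟩ := h s
  obtain ⟨W, hW, hWo, hxW⟩ := eventually_nhds_iff.1 (hφ.and hφπ)
  let W' : Opens X.dom := ⟨W, hWo⟩
  exact ⟨X.dom.opens W', Y.dom, fun z => X.atlas z.1, Y.atlas, fun z => φ z.1, ⟨x, hxW⟩,
    X.isChart_restrict W', Y.isChart_atlas,
    SmoothMfd.smooth_restrict (W := W') fun z hz => (hW z hz).1, hx,
    funext fun z => (hW z.1 z.2).2.symm⟩

end QCharts

end GermCalculus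

end QGeom

namespace QGeom

/-! ### Cocycle identities and gluing at the level of sets. -/

section Gluing

variable {E : Type} [NormedAddCommGroup E] [NormedSpace ℝ E] [FiniteDimensional ℝ E]
variable {F : Type} [NormedAddCommGroup F] [NormedSpace ℝ F] [FiniteDimensional ℝ F]
variable {G : Type u} [Group G] {XG : QManifold F G} {N : SmoothMfd.{u} E} {I : Type u}
  {U : I → Opens N} {ψ : ∀ j i : I, N.opens (U j ⊓ U i) → G}

namespace IsTransitionFamily

theorem self_eq_one (hψ : IsTransitionFamily XG U ψ) (i : I) (n : N) (hn : n ∈ U i) :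
    ψ i i ⟨n, hn, hn⟩ = 1 := by
  simpa using hψ.cocycle i i i n hn hn hn

theorem mul_symm (hψ : IsTransitionFamily XG U ψ) (i j : I) (n : N) (hi : n ∈ U i)
    (hj : n ∈ U j) : ψ i j ⟨n, hi, hj⟩ * ψ j i ⟨n, hj, hi⟩ = 1 := by
  rw [← hψ.cocycle i j i n hi hj hi, hψ.self_eq_one i n hi]

end IsTransitionFamily

variable (ψ) (c : N → I) (hc : ∀ n, n ∈ U (c n))

/-- The total space is `N × G`, the fibre over `n` being identified with `G` by means of the
trivialization of index `c n`; this is the inverse of the trivialization of index `i`. -/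
def glue (i : I) (x : N.opens (U i) × G) : N × G :=
  (x.1.1, ψ (c x.1.1) i ⟨x.1.1, hc x.1.1, x.1.2⟩ * x.2)

/-- The map `⊔ᵢ U i × M → P` associated with `q : M → G`. -/
def glueChart {M : SmoothMfd.{u} F} (q : M → G) :
    SmoothMfd.sigma (fun i => (N.opens (U i)).prod M) → N × G :=
  fun x => glue ψ c hc x.1 (x.2.1, q x.2.2)

variable {ψ}

theorem glue_mul_right (i : I) (n : N.opens (U i)) (g h : G) :
    glue ψ c hc i (n, g * h) = ((glue ψ c hc i (n, g)).1, (glue ψ c hc i (n, g)).2 * h) :=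
  Prod.ext rfl (mul_assoc _ _ _).symm

/-- The cocycle identity factors `ψ (c n) i` as `ψ (c n) j * ψ j i`; cancelling `ψ (c n) j` removes
the choice `c`. -/
theorem glue_eq_iff (hψ : IsTransitionFamily XG U ψ)
    (i j : I) (x : N.opens (U i) × G) (y : N.opens (U j) × G) :
    glue ψ c hc i x = glue ψ c hc j y ↔
      ∃ (n : N) (hx : n ∈ U i) (hy : n ∈ U j),
        (x.1 : N) = n ∧ (y.1 : N) = n ∧ y.2 = ψ j i ⟨n, hy, hx⟩ * x.2 := by
  obtain ⟨⟨n, hx⟩, g⟩ := x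
  obtain ⟨⟨n', hy⟩, g'⟩ := y
  constructor
  · intro h
    obtain rfl : n = n' := congrArg Prod.fst h
    refine ⟨n, hx, hy, rfl, rfl, ?_⟩
    have h2 : ψ (c n) i ⟨n, hc n, hx⟩ * g = ψ (c n) j ⟨n, hc n, hy⟩ * g' := congrArg Prod.snd h
    rw [hψ.cocycle i j (c n) n hx hy (hc n), mul_assoc] at h2
    exact (mul_left_cancel h2).symm
  · rintro ⟨m, hx', hy', h1, h2, h3⟩
    obtain rfl : n = m := h1
    obtain rfl : n' = n := h2
    obtain rfl : g' = ψ j i ⟨n', hy, hx⟩ * g := h3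
    refine Prod.ext rfl ?_
    change ψ (c n') i ⟨n', hc n', hx⟩ * g = ψ (c n') j ⟨n', hc n', hy⟩ * _
    rw [hψ.cocycle i j (c n') n' hx hy (hc n'), mul_assoc]

theorem glue_injective (i : I) : Function.Injective (glue ψ c hc i) := by
  rintro ⟨⟨n, hn⟩, g⟩ ⟨⟨n', hn'⟩, g'⟩ h
  obtain rfl : n = n' := congrArg Prod.fst h
  exact Prod.ext rfl (mul_left_cancel (congrArg Prod.snd h))

theorem glue_inv (hψ : IsTransitionFamily XG U ψ)
    (i : I) (n : N) (hn : n ∈ U i) (g : G) :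
    glue ψ c hc i (⟨n, hn⟩, ψ i (c n) ⟨n, hn, hc n⟩ * g) = (n, g) := by
  refine Prod.ext rfl ?_
  change ψ (c n) i ⟨n, hc n, hn⟩ * (ψ i (c n) ⟨n, hn, hc n⟩ * g) = g
  rw [← mul_assoc, hψ.mul_symm (c n) i n (hc n) hn, one_mul]

/-! ### The glued chart and its local lifts. -/

variable {M M' : SmoothMfd.{u} F} {q : M → G} {q' : M' → G}

theorem glueChart_surjective (hψ : IsTransitionFamily XG U ψ)
    (hq : Function.Surjective q) :
    Function.Surjective (glueChart ψ c hc q) := by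
  rintro ⟨n, g⟩
  obtain ⟨m, hm⟩ := hq (ψ (c n) (c n) ⟨n, hc n, hc n⟩ * g)
  exact ⟨⟨c n, ⟨n, hc n⟩, m⟩, (congrArg (fun g => glue ψ c hc (c n) (⟨n, hc n⟩, g)) hm).trans
    (glue_inv c hc hψ (c n) n (hc n) g)⟩

theorem liftAt_glueChart_mk (i : I) (x : (N.opens (U i)).prod M) :
    LiftAt (M := (N.opens (U i)).prod M) (fun z => glue ψ c hc i (Prod.map id q z))
      (glueChart ψ c hc q) x ⟨i, x⟩ :=
  (isEtaleAt_sigmaMk (X := fun i => (N.opens (U i)).prod M) i x).liftAt (glueChart ψ c hc q)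

theorem liftAt_mk_glueChart (i : I) (x : (N.opens (U i)).prod M) :
    LiftAt (N := (N.opens (U i)).prod M) (glueChart ψ c hc q)
      (fun z => glue ψ c hc i (Prod.map id q z)) ⟨i, x⟩ x :=
  (isEtaleAt_sigmaMk (X := fun i => (N.opens (U i)).prod M) i x).liftAt_symm
    (glueChart ψ c hc q)

/-- This is where `Q`-smoothness of `ψ` and of multiplication enters: `ψ j i` and `q` are lifted to
the atlas of `G`, and the product is then lifted through `q'` to end at the prescribed `m'`. -/
theorem liftAt_transition (hψ : IsTransitionFamily XG U ψ)
    (hG : IsQGroup XG) (hq : XG.IsChart q) (hq' : XG.IsChart q') (i j : I)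
    (w : N.opens (U j ⊓ U i)) (m : M) (m' : M') (h : ψ j i w * q m = q' m') :
    LiftAt (M := (N.opens (U j ⊓ U i)).prod M) (fun z => ψ j i z.1 * q z.2) q' (w, m) m' := by
  obtain ⟨a, ha⟩ := XG.surjective (ψ j i w)
  obtain ⟨b, hb⟩ := XG.surjective (q m)
  have lψ : LiftAt (ψ j i) XG.atlas w a :=
    (hψ.smooth j i).liftAt (QManifold.isChart_atlas _) XG.isChart_atlas ha.symm
  have lmul : LiftAt (M := XG.dom.prod XG.dom)
      (fun z => (Prod.map XG.atlas XG.atlas z).1 * (Prod.map XG.atlas XG.atlas z).2) q'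
      (a, b) m' :=
    hG.smooth_mul.liftAt (QManifold.isChart_atlas _) hq' (by
      change XG.atlas a * XG.atlas b = q' m'
      rw [ha, hb, h])
  exact ((lψ.prodMap (hq.liftAt XG.isChart_atlas hb.symm)).post fun z => z.1 * z.2).trans lmul

/-- Equality of the images puts the base point in `U j ⊓ U i`. Over this overlap, `glue` of index
`i` is `glue` of index `j` after multiplication by `ψ j i`, which lifts by `liftAt_transition`. -/
theorem liftAt_glue (hψ : IsTransitionFamily XG U ψ)
    (hG : IsQGroup XG) (hq : XG.IsChart q) (hq' : XG.IsChart q') (i j : I)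
    (x : (N.opens (U i)).prod M) (y : (N.opens (U j)).prod M')
    (h : glue ψ c hc i (Prod.map id q x) = glue ψ c hc j (Prod.map id q' y)) :
    LiftAt (M := (N.opens (U i)).prod M) (N := (N.opens (U j)).prod M')
      (fun z => glue ψ c hc i (Prod.map id q z)) (fun z => glue ψ c hc j (Prod.map id q' z))
      x y := by
  obtain ⟨⟨n, hi⟩, m⟩ := x
  obtain ⟨⟨n', hj⟩, m'⟩ := y
  obtain ⟨n'', hi', hj', h1, h2, h3⟩ := (glue_eq_iff c hc hψ i j _ _).1 h
  obtain rfl : n = n'' := h1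
  obtain rfl : n' = n := h2
  let W : Opens N := U j ⊓ U i
  let w : N.opens W := ⟨n', hj, hi⟩
  let ri : N.opens W → N.opens (U i) := fun z => ⟨z.1, z.2.2⟩
  let rj : N.opens W → N.opens (U j) := fun z => ⟨z.1, z.2.1⟩
  have sj : SmoothNear rj w :=
    SmoothNear.of_subtypeVal_comp ((SmoothMfd.smooth_subtypeVal W).smoothNear w)
  have lW : LiftAt (M := N.opens (U i)) (fun z => z) ri ⟨n', hi⟩ w := by
    -- Shrinking `U i` to the overlap is checked in `N`, where the inclusion of the overlap is
    -- étale.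
    refine LiftAt.of_post (f := Subtype.val) Subtype.val_injective ?_
    exact LiftAt.pre (K := N.opens (U i)) (f := Subtype.val) (w := ⟨n', hi⟩)
      ((isEtaleAt_subtypeVal w).liftAt_symm (fun z => z))
      ((SmoothMfd.smooth_subtypeVal (U i)).smoothNear _)
  have l1 := (lW.prodMap (LiftAt.refl q m)).post (glue ψ c hc i)
  have l2 : LiftAt (M := (N.opens W).prod M) (N := N.opens (U j)) (fun z => rj z.1)
      (fun z => z) (w, m) ⟨n', hj⟩ :=
    LiftAt.of_smoothNear (M := (N.opens W).prod M) (φ := fun z => rj z.1)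
      (SmoothNear.comp (M := (N.opens W).prod M) (f := Prod.fst) sj
        (SmoothMfd.smooth_fst.smoothNear (w, m))) fun _ => rfl
  have l3 := (l2.prodMk (liftAt_transition hψ hG hq hq' i j w m m' h3.symm)).post
    (glue ψ c hc j)
  exact l1.trans (l3.congr_left fun z =>
    ((glue_eq_iff c hc hψ i j _ _).2 ⟨z.1.1, z.1.2.2, z.1.2.1, rfl, rfl, rfl⟩).symm)

theorem liftAt_glueChart (hψ : IsTransitionFamily XG U ψ)
    (hG : IsQGroup XG) (hq : XG.IsChart q) (hq' : XG.IsChart q')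
    (x : SmoothMfd.sigma (fun i => (N.opens (U i)).prod M))
    (y : SmoothMfd.sigma (fun i => (N.opens (U i)).prod M'))
    (h : glueChart ψ c hc q x = glueChart ψ c hc q' y) :
    LiftAt (glueChart ψ c hc q) (glueChart ψ c hc q') x y :=
  (liftAt_mk_glueChart c hc x.1 x.2).trans
    ((liftAt_glue c hc hψ hG hq hq' x.1 y.1 x.2 y.2 h).trans (liftAt_glueChart_mk c hc y.1 y.2))

theorem isQChart_glueChart (hψ : IsTransitionFamily XG U ψ)
    (hG : IsQGroup XG) (hq : XG.IsChart q) :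
    IsQChart (glueChart ψ c hc q) :=
  isQChart_of_germs (liftAt_glueChart c hc hψ hG hq hq) fun x =>
    SepAt.of_etale (isEtaleAt_sigmaMk (X := fun i => (N.opens (U i)).prod M) x.1 x.2)
      (((sepAt_id (M := N.opens (U x.1)) x.2.1).prodMap (hq.1.sepAt x.2.2)).post
        (glue_injective c hc x.1))

/-! ### The glued `Q`-manifold, its action, trivializations and bundle. -/

/-- The `Q`-manifold obtained by gluing the products `U i × G`. -/
noncomputable def gluedQManifold (hψ : IsTransitionFamily XG U ψ)
    (hG : IsQGroup XG) : QManifold (E × F) (N × G) where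
  dom := SmoothMfd.sigma (fun i => (N.opens (U i)).prod XG.dom)
  atlas := glueChart ψ c hc XG.atlas
  isQChart := isQChart_glueChart c hc hψ hG XG.isChart_atlas
  surjective := glueChart_surjective c hc hψ XG.surjective

theorem isAtlas_glueChart (hψ : IsTransitionFamily XG U ψ)
    (hG : IsQGroup XG) (hq : XG.IsAtlas q) :
    (gluedQManifold c hc hψ hG).IsAtlas (glueChart ψ c hc q) :=
  ⟨⟨isQChart_glueChart c hc hψ hG hq.1,
    qChartEquiv_of_germs (isQChart_glueChart c hc hψ hG hq.1) (gluedQManifold c hc hψ hG).isQChart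
      (liftAt_glueChart c hc hψ hG hq.1 XG.isChart_atlas)
      (liftAt_glueChart c hc hψ hG XG.isChart_atlas hq.1)⟩,
    glueChart_surjective c hc hψ hq.2⟩

/-- The glued `Q`-manifold with its projection to `N` and its right action of `G`. -/
noncomputable def gluedActionOver (hψ : IsTransitionFamily XG U ψ)
    (hG : IsQGroup XG) : QActionOver XG N (E × F) where
  total := N × G
  str := gluedQManifold c hc hψ hG
  act p g := (p.1, p.2 * g)
  act_one p := Prod.ext rfl (mul_one p.2)
  act_mul p g h := Prod.ext rfl (mul_assoc p.2 g h).symm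
  act_free p g h := mul_eq_left.1 (congrArg Prod.snd h)
  act_smooth := by
    refine isQSmooth_of_liftAt fun s => ?_
    obtain ⟨⟨⟨i, n, m⟩, m'⟩, rfl⟩ := ((gluedQManifold c hc hψ hG).prod XG).surjective s
    -- Right multiplication commutes with the left factor `ψ (c n) i`, so on the piece `i` the
    -- action is multiplication in `G`, and any `b` over the product may serve as value of the lift.
    obtain ⟨b, hb⟩ := XG.surjective (XG.atlas m * XG.atlas m')
    refine ⟨_, ⟨i, n, b⟩, rfl, ?_⟩
    let V := (N.opens (U i)).prod XG.dom
    have l1 := ((liftAt_mk_glueChart (ψ := ψ) (q := XG.atlas) c hc i (n, m)).prodMap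
      (LiftAt.refl XG.atlas m')).post fun z => (z.1.1, z.1.2 * z.2)
    have smooth_fst : SmoothNear (M := V.prod XG.dom) (N := V) Prod.fst ((n, m), m') :=
      SmoothMfd.smooth_fst.smoothNear _
    have l2 : LiftAt (M := V.prod XG.dom) (fun z => z.1.1) (fun z => z) ((n, m), m') n :=
      LiftAt.of_smoothNear (φ := fun z : V.prod XG.dom => (z.1.1 : N.opens (U i)))
        (SmoothNear.comp (M := V.prod XG.dom) (N := V) (K := N.opens (U i)) (g := Prod.fst)
          (SmoothMfd.smooth_fst.smoothNear _) smooth_fst) fun _ => rfl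
    have l3 : LiftAt (M := V.prod XG.dom) (fun z => XG.atlas z.1.2 * XG.atlas z.2) XG.atlas
        ((n, m), m') b :=
      (LiftAt.pre (K := V.prod XG.dom) (M := XG.dom.prod XG.dom) (f := fun z => (z.1.2, z.2))
        (hG.smooth_mul.liftAt (QManifold.isChart_atlas _) XG.isChart_atlas
          (x := (m, m')) (y := b) hb.symm)
        (SmoothNear.prodMk
          (SmoothNear.comp (M := V.prod XG.dom) (N := V) (K := XG.dom) (g := Prod.snd)
            (SmoothMfd.smooth_snd.smoothNear _) smooth_fst)
          (SmoothMfd.smooth_snd.smoothNear _)))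
    have l4 := (l2.prodMk l3).post (glue ψ c hc i)
    exact l1.trans ((l4.trans (liftAt_glueChart_mk c hc i (n, b))).congr_left
      fun z => glue_mul_right c hc i z.1.1 (XG.atlas z.1.2) (XG.atlas z.2))
  proj p := p.1
  proj_smooth := by
    refine isQSmooth_of_liftAt fun s => ?_
    obtain ⟨⟨i, n, m⟩, rfl⟩ := (gluedQManifold c hc hψ hG).surjective s
    refine ⟨_, n.1, rfl, ?_⟩
    have l := (liftAt_mk_glueChart (ψ := ψ) (q := XG.atlas) c hc i (n, m)).post Prod.fst
    refine l.trans (LiftAt.of_smoothNear (M := (N.opens (U i)).prod XG.dom)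
      (φ := fun z => (z.1.1 : N)) ?_ fun _ => rfl)
    exact SmoothNear.comp (M := (N.opens (U i)).prod XG.dom) (N := N.opens (U i)) (K := N)
      ((SmoothMfd.smooth_subtypeVal (U i)).smoothNear _) (SmoothMfd.smooth_fst.smoothNear _)

/-- The local trivialization over `U i`. -/
noncomputable def gluedTriv (hψ : IsTransitionFamily XG U ψ)
    (hG : IsQGroup XG) (i : I) :
    LocalTriv (gluedActionOver c hc hψ hG) (U i) :=
  let e : ((gluedActionOver c hc hψ hG).proj ⁻¹' (U i : Set N) : Set (N × G)) ≃
      N.opens (U i) × G :=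
    { toFun := fun p => (⟨p.1.1, p.2⟩, ψ i (c p.1.1) ⟨p.1.1, p.2, hc _⟩ * p.1.2)
      invFun := fun x => ⟨glue ψ c hc i x, x.1.2⟩
      left_inv := fun p => Subtype.ext (glue_inv c hc hψ i p.1.1 p.2 p.1.2)
      right_inv := fun x => glue_injective c hc i (glue_inv c hc hψ i x.1.1 x.1.2 _) }
  have he : ∀ p, glue ψ c hc i (e p) = p.1 := fun p => glue_inv c hc hψ i p.1.1 p.2 p.1.2
  { toEquiv := e
    smooth := by
      refine isQSmooth_of_liftAt fun s => ?_
      obtain ⟨m, hm⟩ := XG.surjective (e s).2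
      have hs : glueChart ψ c hc XG.atlas ⟨i, (e s).1, m⟩ = s.1 :=
        (congrArg (fun g => glue ψ c hc i ((e s).1, g)) hm).trans (he s)
      let x : ((gluedActionOver c hc hψ hG).over (U i)).dom := ⟨⟨i, (e s).1, m⟩, (e s).1.2⟩
      -- Composed with the injective inverse `glue ψ c hc i`, the trivialization becomes the
      -- inclusion of the preimage of `U i` into the total space.
      refine ⟨x, ((e s).1, m), Subtype.ext hs, LiftAt.of_post (glue_injective (ψ := ψ) c hc i) ?_⟩
      exact (((isEtaleAt_subtypeVal x).liftAt (glueChart ψ c hc XG.atlas)).trans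
        (liftAt_mk_glueChart c hc i ((e s).1, m))).congr_left
          fun z => (he (((gluedActionOver c hc hψ hG).over (U i)).atlas z)).symm
    smooth_symm := by
      refine isQSmooth_of_liftAt fun s => ?_
      obtain ⟨n, g⟩ := s
      obtain ⟨m, rfl⟩ := XG.surjective g
      let x : ((gluedActionOver c hc hψ hG).over (U i)).dom := ⟨⟨i, n, m⟩, n.2⟩
      refine ⟨(n, m), x, rfl, LiftAt.of_post Subtype.val_injective ?_⟩
      exact (liftAt_glueChart_mk c hc i (n, m)).trans
        ((isEtaleAt_subtypeVal x).liftAt_symm (glueChart ψ c hc XG.atlas))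
    fst_eq := fun _ => rfl
    equivariant := by
      rintro ⟨⟨n, g⟩, hp⟩ ⟨⟨n', g'⟩, hq⟩ h hpq
      obtain rfl : n' = n := congrArg Prod.fst hpq
      obtain rfl : g' = g * h := congrArg Prod.snd hpq
      exact Prod.ext rfl (mul_assoc _ _ _).symm }

/-- The `Q`-principal bundle obtained by gluing the products `U i × G` along the transition
functions `ψ j i`. -/
noncomputable def gluedBundle (hψ : IsTransitionFamily XG U ψ)
    (hG : IsQGroup XG) : QPrincipalBundle XG N (E × F) where
  toQActionOver := gluedActionOver c hc hψ hG
  fiber_eq := by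
    rintro ⟨n, g⟩
    refine Set.Subset.antisymm ?_ ?_
    · rintro ⟨n', g'⟩ h
      obtain rfl : n' = n := h
      exact ⟨g⁻¹ * g', Prod.ext rfl (mul_inv_cancel_left g g')⟩
    · rintro _ ⟨h, rfl⟩
      rfl
  locally_trivial n := ⟨U (c n), hc n, ⟨gluedTriv c hc hψ hG (c n)⟩⟩

end Gluing

end QGeom

/-! ### Existence of the bundle and description of its atlases. -/

theorem proposition3p7
    {E : Type} [NormedAddCommGroup E] [NormedSpace ℝ E] [FiniteDimensional ℝ E]
    {F : Type} [NormedAddCommGroup F] [NormedSpace ℝ F] [FiniteDimensional ℝ F]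
    {G : Type u} [Group G] (XG : QGeom.QManifold F G) (hG : QGeom.IsQGroup XG)
    (N : QGeom.SmoothMfd.{u} E) {I : Type u} (U : I → Opens N) (hU : ∀ n : N, ∃ i, n ∈ U i)
    (ψ : ∀ j i : I, N.opens (U j ⊓ U i) → G) (hψ : QGeom.IsTransitionFamily XG U ψ) :
    ∃ (B : QGeom.QPrincipalBundle XG N (E × F))
      (e : ∀ i, QGeom.LocalTriv B.toQActionOver (U i)),
      (∀ i j, QGeom.IsTransitionFunction (e i) (e j) (ψ j i)) ∧
      ∀ (M : QGeom.SmoothMfd.{u} F) (q : M → G), XG.IsAtlas q →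
        B.str.IsAtlas (QGeom.gluingMap e q) ∧
        (∀ i (n : N.opens (U i)) (m : M), B.proj (QGeom.gluingMap e q ⟨i, n, m⟩) = n) ∧
        (∀ i (n : N.opens (U i)) (m m' : M) (g : G), q m' = q m * g →
          B.act (QGeom.gluingMap e q ⟨i, n, m⟩) g = QGeom.gluingMap e q ⟨i, n, m'⟩) ∧
        ∀ x y : (Σ i, N.opens (U i) × M),
          QGeom.gluingMap e q x = QGeom.gluingMap e q y ↔
            ∃ (n : N) (hx : n ∈ U x.1) (hy : n ∈ U y.1),
              (x.2.1 : N) = n ∧ (y.2.1 : N) = n ∧ q y.2.2 = ψ y.1 x.1 ⟨n, hy, hx⟩ * q x.2.2 := by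
  choose c hc using hU
  -- The inverse of the trivialization of index `i` is `glue` of index `i` by construction, so
  -- `gluingMap` is definitionally `glueChart`.
  refine ⟨QGeom.gluedBundle c hc hψ hG, QGeom.gluedTriv c hc hψ hG, ?_, fun M q hq =>
    ⟨QGeom.isAtlas_glueChart c hc hψ hG hq, fun _ _ _ => rfl, ?_, fun x y =>
      QGeom.glue_eq_iff c hc hψ x.1 y.1 (x.2.1, q x.2.2) (y.2.1, q y.2.2)⟩⟩
  · rintro i j ⟨n, g⟩ (hi : n ∈ U i) (hj : n ∈ U j)
    change ψ j i ⟨n, hj, hi⟩ =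
      ψ j (c n) ⟨n, hj, hc n⟩ * g * (ψ i (c n) ⟨n, hi, hc n⟩ * g)⁻¹
    -- After clearing the inverse this is the cocycle identity from `c n` through `i` to `j`.
    rw [eq_mul_inv_iff_mul_eq, ← mul_assoc, ← hψ.cocycle (c n) i j n (hc n) hi hj]
  · intro i n m m' g h
    have h1 := QGeom.glue_mul_right (ψ := ψ) c hc i n (q m) g
    rw [← h] at h1
    exact h1.symm
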